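/- Let $(\Omega,\mathcal F,P)$ be a probability space with a filtration $\mathbb F$ (complete information), a subfiltration $\widetilde{\mathbb F}\subset\mathbb F$ (observable information), and let $T>0$. Let $\widetilde S=\widetilde N+\widetilde A$ be a càdlàg $\widetilde{\mathbb F}$-adapted price process, where on $[0,T]$ the process $\widetilde N$ is a càdlàg square-integrable $(\widetilde{\mathbb F},P)$-martingale with predictable quadratic variation $\langle\widetilde N\rangle$, and $\widetilde A$ is $\widetilde{\mathbb F}$-predictable with total variation on $[0,T]$ in $L^2(P)$. Let $\widetilde P\sim P$ be a probability measure under which $\widetilde S$ is an $\widetilde{\mathbb F}$-martingale on $[0,T]$, and suppose that the density $D_T=d\widetilde P|_{\widetilde{\mathcal F}_T}/dP|_{\widetilde{\mathcal F}_T}$ satisfies $\mathbb E D_T^2<\infty$. A strategy is an $\widetilde{\mathbb F}$-predictable process $\xi$ with $\int_0^T\xi_s^2\,d\langle\widetilde N\rangle_s<\infty$ and $\int_0^T|\xi_s|\,d|\widetilde A|_s<\infty$ a.s., for which the stochastic integral $\int_0^t\xi\,d\widetilde S$, $t\in[0,T]$, is defined. For $x\in\mathbb R$ and a random variable $K\ge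 0$, let $\Xi(x,K)$ be the set of strategies $\xi$ with $x+\int_0^T\xi\,d\widetilde S\ge K$ a.s. whose wealth process is nonnegative: a.s., $x+\int_0^t\xi\,d\widetilde S\ge0$ for all $t\in[0,T]$. Say that $\xi$ replicates a claim $h\ge0$ from the capital $x$ if $\xi\in\Xi(x,0)$ and $h=x+\int_0^T\xi\,d\widetilde S$ a.s. Suppose that the observable market is complete: every nonnegative $\widetilde{\mathcal F}_T$-measurable $h\in L^2(P)$ is replicated by some $\xi$ from the capital $\mathbb E_{\widetilde P}h$. (i) Let $G\ge0$ be $\widetilde{\mathcal F}_T$-measurable with $\mathbb E G^2<\infty$ and let $0<g<\mathbb E_{\widetilde P}G$. Then there is a unique $v(g)\in\mathbb R$ with $\mathbb E_{\widetilde P}(G+v(g)D_T)^+=g$; there is a $\widetilde\xi$ which replicates $(G+v(g)D_T)^+$ from the capital $g$, that is, $(G+v(g)D_T)^+=g+\int_0^T\widetilde\xi\,d\widetilde S$; and every such $\widetilde\xi$ minimizes $\mathbb E\big(G-g-\int_0^T\xi\,d\widetilde S\big)^2$ over $\xi\in\Xi(g,0)$, the minimum being finite. (ii) Let $H,\widetilde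 H\ge0$ be square-integrable, $H$ being $\mathcal F_T$-measurable and $\widetilde H$ being $\widetilde{\mathcal F}_T$-measurable, put $H_1=\mathbb E(H\mid\widetilde{\mathcal F}_T)$, and let $H_1\ge\widetilde H$ a.s. and $\mathbb E_{\widetilde P}\widetilde H<x<\mathbb E_{\widetilde P}H_1$. Put $G=H_1-\widetilde H$ and $g=x-\mathbb E_{\widetilde P}\widetilde H$. Then there is a unique $v(g)$ with $\mathbb E_{\widetilde P}(G+v(g)D_T)^+=g$, there are $\widetilde\xi$ replicating $(G+v(g)D_T)^+$ from the capital $g$ and $\eta$ replicating $\widetilde H$ from the capital $\mathbb E_{\widetilde P}\widetilde H$, and for all such $\widetilde\xi$ and $\eta$ the strategy $\widetilde\xi+\eta$ minimizes $\mathbb E\big(H-x-\int_0^T\xi\,d\widetilde S\big)^2$ over $\xi\in\Xi(x,\widetilde H)$, the minimum being finite. -/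

import Mathlib

open MeasureTheory ProbabilityTheory Filter Topology

open scoped NNReal ENNReal

noncomputable section

namespace Hedging

/-- Real-valued càdlàg functions of time: right-continuous, with finite left limits. -/
def IsCadlag (f : ℝ≥0 → ℝ) : Prop :=
  ∀ t, ContinuousWithinAt f (Set.Ici t) t ∧ ∃ l : ℝ, Tendsto f (𝓝[<] t) (𝓝 l)

/-- The Lebesgue-Stieltjes measure `df` of a nondecreasing right-continuous function
(with the harmless value `0` if `f` is not monotone, which below happens only on null sets). -/
def pathMeasure (f : ℝ≥0 → ℝ) : Measure ℝ≥0 :=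
  open Classical in if h : Monotone f then h.stieltjesFunction.measure else 0

/-- The total variation of the path `f` on `[0, t ∧ T]`, as a function of `t`. -/
def pathVariation (T : ℝ≥0) (f : ℝ≥0 → ℝ) (t : ℝ≥0) : ℝ :=
  (eVariationOn f (Set.Icc 0 (min t T))).toReal

variable {Ω : Type*} [MeasurableSpace Ω]

/-- `X` is a martingale on the time interval `[0, T]`. -/
def MartingaleOn (T : ℝ≥0) (X : ℝ≥0 → Ω → ℝ) (𝔽 : Filtration ℝ≥0 ‹MeasurableSpace Ω›)
    (μ : Measure Ω) : Prop :=
  Martingale (fun t => X (min t T)) 𝔽 μ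

/-- `Q` is the predictable quadratic variation `⟨N⟩` on `[0, T]`: the predictable, nondecreasing,
right-continuous process, null at `0`, such that `N ^ 2 - Q` is a martingale. -/
structure IsPredictableBracket (T : ℝ≥0) (N Q : ℝ≥0 → Ω → ℝ)
    (𝔽 : Filtration ℝ≥0 ‹MeasurableSpace Ω›) (P : Measure Ω) : Prop where
  predictable : IsStronglyPredictable 𝔽 Q
  zero : ∀ ω, Q 0 ω = 0
  mono : ∀ ω, Monotone (fun t => Q t ω)
  right_cont : ∀ ω t, ContinuousWithinAt (fun s => Q s ω) (Set.Ici t) t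
  martingale : MartingaleOn T (fun t ω => N t ω ^ 2 - Q t ω) 𝔽 P

/-- The density `d P̃_T / d P_T` of the restrictions of the two measures to the `σ`-algebra `𝔽 T`. -/
def densityAt (P Pt : Measure Ω) (𝔽 : Filtration ℝ≥0 ‹MeasurableSpace Ω›) (T : ℝ≥0) : Ω → ℝ :=
  fun ω => ((Pt.trim (𝔽.le T)).rnDeriv (P.trim (𝔽.le T)) ω).toReal

/-- Simple predictable processes `∑ i, H i * 1_{(s i, t i]}`, where `H i` is bounded and
`𝔽 (s i)`-measurable. -/
structure SimpleStrategy (𝔽 : Filtration ℝ≥0 ‹MeasurableSpace Ω›) where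
  n : ℕ
  s : Fin n → ℝ≥0
  t : Fin n → ℝ≥0
  s_le_t : ∀ i, s i ≤ t i
  H : Fin n → Ω → ℝ
  measurable_H : ∀ i, StronglyMeasurable[𝔽 (s i)] (H i)
  bounded_H : ∃ C : ℝ, ∀ i ω, |H i ω| ≤ C

namespace SimpleStrategy

variable {𝔽 : Filtration ℝ≥0 ‹MeasurableSpace Ω›}

/-- The value of the simple process at time `u`. -/
def val (θ : SimpleStrategy 𝔽) (u : ℝ≥0) (ω : Ω) : ℝ :=
  ∑ i, (Set.Ioc (θ.s i) (θ.t i)).indicator (fun _ => θ.H i ω) u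

/-- The elementary integral `∫_0^u θ dS`. -/
def integral (θ : SimpleStrategy 𝔽) (S : ℝ≥0 → Ω → ℝ) (u : ℝ≥0) (ω : Ω) : ℝ :=
  ∑ i, θ.H i ω * (S (min (θ.t i) u) ω - S (min (θ.s i) u) ω)

end SimpleStrategy

/-- The observable market `{1, S}` inside a larger market with partial observations, on the
finite horizon `[0, T]`. -/
structure Market (Ω : Type*) [MeasurableSpace Ω] where
  /-- the horizon -/
  T : ℝ≥0
  T_pos : 0 < T
  /-- the objective probability measure -/
  P : Measure Ω
  prob_P : IsProbabilityMeasure P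
  /-- the complete information -/
  full : Filtration ℝ≥0 ‹MeasurableSpace Ω›
  /-- the observable information -/
  obs : Filtration ℝ≥0 ‹MeasurableSpace Ω›
  obs_le_full : obs ≤ full
  /-- the price of the observable risky asset -/
  S : ℝ≥0 → Ω → ℝ
  /-- the martingale part of `S` -/
  N : ℝ≥0 → Ω → ℝ
  /-- the predictable part of `S` -/
  A : ℝ≥0 → Ω → ℝ
  /-- the predictable quadratic variation of `N` -/
  Q : ℝ≥0 → Ω → ℝ
  /-- the equivalent martingale measure -/
  Pt : Measure Ω
  prob_Pt : IsProbabilityMeasure Pt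
  adapted_S : StronglyAdapted obs S
  cadlag_S : ∀ ω, IsCadlag (fun t => S t ω)
  decomposition : ∀ t ω, S t ω = N t ω + A t ω
  cadlag_N : ∀ ω, IsCadlag (fun t => N t ω)
  martingale_N : MartingaleOn T N obs P
  memLp_N : MemLp (N T) 2 P
  bracket_N : IsPredictableBracket T N Q obs P
  predictable_A : IsStronglyPredictable obs A
  variation_A : ∫⁻ ω, eVariationOn (fun t => A t ω) (Set.Icc 0 T) ^ 2 ∂P < ∞
  Pt_ac : Pt ≪ P
  P_ac : P ≪ Pt
  martingale_S : MartingaleOn T S obs Pt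
  memLp_density : MemLp (densityAt P Pt obs T) 2 P

namespace Market

variable (M : Market Ω)

/-- The density `D_T` of the martingale measure on the observable information up to `T`. -/
def D : Ω → ℝ := densityAt M.P M.Pt M.obs M.T

/-- The random measure `d⟨N⟩`. -/
def dQ (ω : Ω) : Measure ℝ≥0 := pathMeasure (fun t => M.Q t ω)

/-- The random measure `d|A|` on `[0, T]`. -/
def dV (ω : Ω) : Measure ℝ≥0 := pathMeasure (pathVariation M.T (fun t => M.A t ω))

/-- The size `∫_0^T ξ² d⟨N⟩ + ∫_0^T |ξ| d|A|` of an integrand. -/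
def size (ξ : ℝ≥0 → Ω → ℝ) (ω : Ω) : ℝ≥0∞ :=
  (∫⁻ t in Set.Ioc 0 M.T, ‖ξ t ω‖ₑ ^ 2 ∂(M.dQ ω)) + ∫⁻ t in Set.Ioc 0 M.T, ‖ξ t ω‖ₑ ∂(M.dV ω)

/-- `X` is (a version of) the stochastic integral process
`X_t = ∫_0^t ξ dS = ∫_0^t ξ dN + ∫_0^t ξ dA`, `t ∈ [0, T]`.

It is the adapted càdlàg process obtained from elementary integrals by approximation and
localization: there are simple processes `θ n` converging to `ξ` (that is,
`∫_0^T (θ n - ξ)² d⟨N⟩ + ∫_0^T |θ n - ξ| d|A| → 0` in probability), whose elementary integrals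
converge to `X` uniformly on `[0, T]`, locally in `L²`.
By the Itô isometry and Lenglart's inequality, `X` is determined up to indistinguishability
on `[0, T]`. -/
structure IsStochasticIntegral (ξ X : ℝ≥0 → Ω → ℝ) : Prop where
  adapted : StronglyAdapted M.obs X
  cadlag : ∀ ω, IsCadlag (fun t => X t ω)
  approx : ∃ (θ : ℕ → SimpleStrategy M.obs) (τ : ℕ → Ω → WithTop ℝ≥0),
    IsLocalizingSequence M.obs τ M.P ∧
    (∀ ε : ℝ≥0∞, 0 < ε →
      Tendsto (fun n => M.P {ω | ε ≤ M.size (fun t ω => (θ n).val t ω - ξ t ω) ω})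
        atTop (𝓝 0)) ∧
    (∀ k, Tendsto
      (fun n => ∫⁻ ω, (⨆ (t : ℝ≥0) (_ : t ≤ M.T ∧ (t : WithTop ℝ≥0) ≤ τ k ω),
        ‖(θ n).integral M.S t ω - X t ω‖ₑ ^ 2) ∂M.P)
      atTop (𝓝 0))

/-- The class of strategies: predictable (for the observable information), with
`∫_0^T ξ² d⟨N⟩ < ∞` and `∫_0^T |ξ| d|A| < ∞` almost surely. -/
structure IsStrategy (ξ : ℝ≥0 → Ω → ℝ) : Prop where
  predictable : IsStronglyPredictable M.obs ξ
  sq_integrable : ∀ᵐ ω ∂M.P, ∫⁻ t in Set.Ioc 0 M.T, ‖ξ t ω‖ₑ ^ 2 ∂(M.dQ ω) < ∞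
  integrable : ∀ᵐ ω ∂M.P, ∫⁻ t in Set.Ioc 0 M.T, ‖ξ t ω‖ₑ ∂(M.dV ω) < ∞

/-- `ξ`, with gains process `X = ∫ ξ dS`, is an admissible strategy for the initial capital `x`
and the terminal constraint `x + ∫_0^T ξ dS ≥ K`. As usual, doubling and suicide strategies are
excluded by requiring the wealth process of an admissible portfolio to be nonnegative. -/
structure Admissible (x : ℝ) (K : Ω → ℝ) (ξ X : ℝ≥0 → Ω → ℝ) : Prop where
  strategy : M.IsStrategy ξ
  gains : M.IsStochasticIntegral ξ X
  nonneg : ∀ᵐ ω ∂M.P, ∀ t ≤ M.T, 0 ≤ x + X t ω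
  terminal : ∀ᵐ ω ∂M.P, K ω ≤ x + X M.T ω

/-- The admissible strategy `ξ` with initial capital `x` replicates the claim `h`:
`h = x + ∫_0^T ξ dS` almost surely. -/
def Replicates (x : ℝ) (h : Ω → ℝ) (ξ : ℝ≥0 → Ω → ℝ) : Prop :=
  ∃ X, M.Admissible x 0 ξ X ∧ ∀ᵐ ω ∂M.P, h ω = x + X M.T ω

/-- The observable market is complete: every nonnegative square-integrable observable claim is
replicated by an admissible strategy, at the price given by the martingale measure. -/
def IsComplete : Prop :=
  ∀ h : Ω → ℝ, StronglyMeasurable[M.obs M.T] h → MemLp h 2 M.P → (∀ᵐ ω ∂M.P, 0 ≤ h ω) →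
    ∃ ξ, M.Replicates (∫ ω, h ω ∂M.Pt) h ξ

/-- The mean-square hedging error `E (H - x - ∫_0^T ξ dS)²`, in `[0, ∞]`, for the gains
process `X = ∫ ξ dS`. -/
def risk (H : Ω → ℝ) (x : ℝ) (X : ℝ≥0 → Ω → ℝ) : ℝ≥0∞ :=
  ∫⁻ ω, ‖H ω - x - X M.T ω‖ₑ ^ 2 ∂M.P

/-- `ξ` solves the problem of minimizing `E (H - x - ∫_0^T ξ dS)²` over all admissible strategies
satisfying the terminal constraint `x + ∫_0^T ξ dS ≥ K`, and the minimum is finite. -/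
def Solves (x : ℝ) (K H : Ω → ℝ) (ξ : ℝ≥0 → Ω → ℝ) : Prop :=
  ∃ X, M.Admissible x K ξ X ∧ M.risk H x X < ∞ ∧
    ∀ η Y, M.Admissible x K η Y → M.risk H x X ≤ M.risk H x Y

end Market

end Hedging

end

/-!
The terminal wealth of an admissible strategy is a nonnegative observable random variable `f`, and
what can be attained from the capital `g` is governed by the budget inequality `Ẽ f ≤ g`, where
`Ẽ f = E (D f)`. Hedging thus reduces to a projection problem in `L²(P)`: minimize `E (G - f)²` over
`f ≥ 0` with `E (D f) ≤ g`. Its solution is `(G + v D)⁺`, where the multiplier `v ≤ 0` is the one for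
which the budget is spent exactly (`existsUnique_multiplier`, `integral_sq_sub_posPart_le`), and
completeness of the market turns this claim into a strategy. For a general claim `H` with the floor
`K`, only `E (H | 𝔽̃_T)` matters, because `f` is observable (`integral_sq_sub_eq`), and subtracting `K`
from the wealth leads back to the case of a nonnegative wealth (`risk_minimal`).

The budget inequality (`integral_terminal_le`) needs the stochastic integral. By definition the gains
process is, up to each localizing time, the `L²(P)`-limit of elementary integrals. These have mean
zero under the martingale measure at bounded stopping times, by optional sampling in continuous time
(`optional_sampling`). Since `D` is square-integrable, `L²(P)`-convergence implies
`L¹(P̃)`-convergence (`lintegral_enorm_Pt_le`), so the stopped gains have mean zero as well, and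
Fatou's lemma removes the localization.

That the sum of two strategies has the sum of the gains (`IsStochasticIntegral.add`) is checked on the
approximating simple strategies. Measurability of running suprema, which is needed to add
upper bounds for integrals, comes from the right-continuity of the paths (`measurable_iSup_path`).
-/

noncomputable section

namespace Hedging

/-! ### Sampling right-continuous processes at random times -/

/-- The approximation from above of the time `r` by the grid of mesh `1 / (n + 1)`, capped at the
horizon `t`. The next grid point is strictly later than `r`, which makes a discretized stopping
time a stopping time again. -/
def gridAbove (t : ℝ≥0) (n : ℕ) (r : ℝ≥0) : ℝ≥0 :=
  min t ((⌊((n : ℝ≥0) + 1) * r⌋₊ + 1) / ((n : ℝ≥0) + 1))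

lemma gridAbove_le (t : ℝ≥0) (n : ℕ) (r : ℝ≥0) : gridAbove t n r ≤ t := min_le_left _ _

lemma le_gridAbove {t r : ℝ≥0} (h : r ≤ t) (n : ℕ) : r ≤ gridAbove t n r := by
  refine le_min h ?_
  rw [le_div_iff₀ (by positivity), mul_comm]
  exact (Nat.lt_floor_add_one _).le

lemma tendsto_gridAbove {t r : ℝ≥0} (h : r ≤ t) :
    Tendsto (fun n => gridAbove t n r) atTop (𝓝[≥] r) := by
  refine tendsto_nhdsWithin_iff.2 ⟨?_, .of_forall fun n => le_gridAbove h n⟩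
  have h1 : Tendsto (fun n : ℕ => r + 1 / ((n : ℝ≥0) + 1)) atTop (𝓝 r) := by
    simpa using tendsto_const_nhds.add (tendsto_one_div_add_atTop_nhds_zero_nat (𝕜 := ℝ≥0))
  refine tendsto_of_tendsto_of_tendsto_of_le_of_le tendsto_const_nhds h1
    (fun n => le_gridAbove h n) fun n => (min_le_right _ _).trans ?_
  rw [add_div]
  gcongr
  rw [div_le_iff₀ (by positivity), mul_comm r]
  exact Nat.floor_le (by positivity)

lemma gridAbove_le_iff {t r u : ℝ≥0} (n : ℕ) (hu : u < t) :
    gridAbove t n r ≤ u ↔ r < ⌊((n : ℝ≥0) + 1) * u⌋₊ / ((n : ℝ≥0) + 1) := by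
  have h0 : (0 : ℝ≥0) < (n : ℝ≥0) + 1 := by positivity
  rw [gridAbove, min_le_iff, or_iff_right (not_le.2 hu), div_le_iff₀ h0, lt_div_iff₀ h0,
    mul_comm u, mul_comm r, ← Nat.floor_lt (by positivity), ← Nat.cast_add_one,
    ← Nat.le_floor_iff (by positivity), Nat.succ_le_iff]

/-- A right-continuous process observed up to time `t` can be sampled measurably at any random time
with values in `[0, t]`. -/
lemma stronglyMeasurable_sample {Ω : Type*} {m : MeasurableSpace Ω} {X : ℝ≥0 → Ω → ℝ} {t : ℝ≥0}
    (hX : ∀ s ≤ t, StronglyMeasurable (X s))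
    (hc : ∀ ω s, ContinuousWithinAt (fun s => X s ω) (Set.Ici s) s)
    {ρ : Ω → ℝ≥0} (hρ : Measurable ρ) (hρt : ∀ ω, ρ ω ≤ t) :
    StronglyMeasurable fun ω => X (ρ ω) ω := by
  have key : ∀ n, StronglyMeasurable fun ω => X (gridAbove t n (ρ ω)) ω := by
    intro n
    have h1 : ∀ k : ℕ, Measurable fun ω => X (min t ((k + 1) / ((n : ℝ≥0) + 1))) ω := fun k =>
      (hX (min t ((k + 1) / ((n : ℝ≥0) + 1))) (min_le_left _ _)).measurable
    have h2 : Measurable fun p : Ω × ℕ => X (min t ((p.2 + 1) / ((n : ℝ≥0) + 1))) p.1 :=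
      measurable_from_prod_countable_left h1
    have h3 : Measurable fun ω => ⌊((n : ℝ≥0) + 1) * ρ ω⌋₊ :=
      Nat.measurable_floor.comp (hρ.const_mul _)
    have h4 : Measurable fun ω => (ω, ⌊((n : ℝ≥0) + 1) * ρ ω⌋₊) := measurable_id.prodMk h3
    have h5 := h2.comp h4
    exact h5.stronglyMeasurable
  have hlim : ∀ ω, Tendsto (fun n => X (gridAbove t n (ρ ω)) ω) atTop (𝓝 (X (ρ ω) ω)) :=
    fun ω => (hc ω (ρ ω)).tendsto.comp (tendsto_gridAbove (hρt ω))
  exact stronglyMeasurable_of_tendsto atTop key (tendsto_pi_nhds.2 hlim)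

variable {Ω : Type*} {m0 : MeasurableSpace Ω}

/-- The bounded real-valued time `τ ∧ T`. -/
def truncate (T : ℝ≥0) (τ : Ω → WithTop ℝ≥0) (ω : Ω) : ℝ≥0 := (min (τ ω) T).untopD 0

lemma coe_truncate (T : ℝ≥0) (τ : Ω → WithTop ℝ≥0) (ω : Ω) :
    (truncate T τ ω : WithTop ℝ≥0) = min (τ ω) T := by
  unfold truncate
  cases h : τ ω with
  | top => rw [min_eq_right le_top]; rfl
  | coe a => rw [← WithTop.coe_min]; rfl

lemma truncate_le (T : ℝ≥0) (τ : Ω → WithTop ℝ≥0) (ω : Ω) : truncate T τ ω ≤ T := by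
  rw [← WithTop.coe_le_coe, coe_truncate]; exact min_le_right _ _

lemma isStoppingTime_truncate {𝔽 : Filtration ℝ≥0 m0} {τ : Ω → WithTop ℝ≥0}
    (hτ : IsStoppingTime 𝔽 τ) (T : ℝ≥0) :
    IsStoppingTime 𝔽 fun ω => (truncate T τ ω : WithTop ℝ≥0) := by
  simp_rw [coe_truncate]
  exact hτ.min_const T

/-- A stopping time bounded by `t` is measurable with respect to the information at time `t`. -/
lemma measurable_of_isStoppingTime {𝔽 : Filtration ℝ≥0 m0} {ρ : Ω → ℝ≥0} {t : ℝ≥0}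
    (hρ : IsStoppingTime 𝔽 fun ω => (ρ ω : WithTop ℝ≥0)) (hρt : ∀ ω, ρ ω ≤ t) :
    Measurable[𝔽 t] ρ := by
  refine @measurable_of_Iic ℝ≥0 Ω _ _ _ (𝔽 t) _ _ _ ρ fun u => ?_
  rcases le_total t u with h | h
  · convert! @MeasurableSet.univ _ (𝔽 t)
    exact Set.eq_univ_of_forall fun ω => (hρt ω).trans h
  · have := 𝔽.mono h _ (hρ u)
    simp only [WithTop.coe_le_coe] at this
    exact this

lemma isStoppingTime_gridAbove {𝔽 : Filtration ℝ≥0 m0} {ρ : Ω → ℝ≥0}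
    (hρ : IsStoppingTime 𝔽 fun ω => (ρ ω : WithTop ℝ≥0)) (t : ℝ≥0) (n : ℕ) :
    IsStoppingTime 𝔽 fun ω => (gridAbove t n (ρ ω) : WithTop ℝ≥0) := by
  intro u
  simp only [WithTop.coe_le_coe]
  rcases le_or_gt t u with h | h
  · convert! @MeasurableSet.univ _ (𝔽 u)
    exact Set.eq_univ_of_forall fun ω => (gridAbove_le _ _ _).trans h
  · simp only [gridAbove_le_iff n h]
    have h1 := hρ.measurableSet_lt (⌊((n : ℝ≥0) + 1) * u⌋₊ / ((n : ℝ≥0) + 1))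
    simp only [WithTop.coe_lt_coe] at h1
    refine 𝔽.mono ?_ _ h1
    rw [div_le_iff₀ (by positivity), mul_comm u]
    exact Nat.floor_le (by positivity)

lemma countable_range_gridAbove (ρ : Ω → ℝ≥0) (t : ℝ≥0) (n : ℕ) :
    (Set.range fun ω => (gridAbove t n (ρ ω) : WithTop ℝ≥0)).Countable := by
  refine (Set.countable_range fun k : ℕ =>
    ((min t ((k + 1) / ((n : ℝ≥0) + 1)) : ℝ≥0) : WithTop ℝ≥0)).mono ?_
  rintro _ ⟨ω, rfl⟩
  exact ⟨_, rfl⟩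

/-- Optional sampling in continuous time: a right-continuous martingale keeps its mean, tested
against the information at time `s`, when it is sampled at a stopping time `σ` with `s ≤ σ ≤ t`.
The countably-valued discretizations of `σ` from above reduce this to the countable case; the
sampled values are conditional expectations of `X t`, hence uniformly integrable. -/
lemma optional_sampling {μ : Measure Ω} [IsProbabilityMeasure μ] {𝔽 : Filtration ℝ≥0 m0}
    {X : ℝ≥0 → Ω → ℝ} (hX : Martingale X 𝔽 μ)
    (hc : ∀ ω s, ContinuousWithinAt (fun s => X s ω) (Set.Ici s) s)
    {σ : Ω → ℝ≥0} (hσ : IsStoppingTime 𝔽 fun ω => (σ ω : WithTop ℝ≥0)) {s t : ℝ≥0}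
    (hs : ∀ ω, s ≤ σ ω) (ht : ∀ ω, σ ω ≤ t) {H : Ω → ℝ} (hH : StronglyMeasurable[𝔽 s] H) {C : ℝ}
    (hC : ∀ ω, |H ω| ≤ C) :
    Integrable (fun ω => X (σ ω) ω) μ ∧ ∫ ω, H ω * X (σ ω) ω ∂μ = ∫ ω, H ω * X s ω ∂μ := by
  obtain hΩ | ⟨⟨ω₀⟩⟩ := isEmpty_or_nonempty Ω
  · simp [Measure.eq_zero_of_isEmpty μ]
  have hst : s ≤ t := (hs ω₀).trans (ht ω₀)
  have hHm : StronglyMeasurable H := hH.mono (𝔽.le s)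
  -- testing a conditional expectation against `H`
  have test : ∀ m : MeasurableSpace Ω, ∀ hm : m ≤ m0, 𝔽 s ≤ m →
      ∫ ω, H ω * (μ[X t | m]) ω ∂μ = ∫ ω, H ω * X t ω ∂μ := by
    intro m hm hsm
    have h1 := condExp_stronglyMeasurable_mul_of_bound hm (hH.mono hsm) (hX.integrable t) C
      (ae_of_all μ hC)
    rw [← integral_condExp (f := fun ω => H ω * X t ω) hm]
    exact (integral_congr_ae h1).symm
  set Y : ℕ → Ω → ℝ := fun n ω => X (gridAbove t n (σ ω)) ω with hY
  have hst' : ∀ n, IsStoppingTime 𝔽 fun ω => (gridAbove t n (σ ω) : WithTop ℝ≥0) :=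
    isStoppingTime_gridAbove hσ t
  have hce : ∀ n, Y n =ᵐ[μ] μ[X t | (hst' n).measurableSpace] := fun n =>
    hX.stoppedValue_ae_eq_condExp_of_le_const_of_countable_range (hst' n)
      (fun ω => WithTop.coe_le_coe.2 (gridAbove_le t n _)) (countable_range_gridAbove σ t n)
  have hUI : UniformIntegrable Y 1 μ :=
    ((hX.integrable t).uniformIntegrable_condExp fun n => (hst' n).measurableSpace_le).ae_eq
      fun n => (hce n).symm
  have hlim : ∀ ω, Tendsto (fun n => Y n ω) atTop (𝓝 (X (σ ω) ω)) := fun ω =>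
    (hc ω (σ ω)).tendsto.comp (tendsto_gridAbove (ht ω))
  have hsm : StronglyMeasurable fun ω => X (σ ω) ω :=
    stronglyMeasurable_sample (fun u _ => (hX.stronglyMeasurable u).mono (𝔽.le u)) hc
      ((measurable_of_isStoppingTime hσ ht).mono (𝔽.le t) le_rfl) ht
  have hmem : MemLp (fun ω => X (σ ω) ω) 1 μ := by
    obtain ⟨B, hB⟩ := hUI.2.2
    refine ⟨hsm.aestronglyMeasurable, ?_⟩
    refine (Lp.eLpNorm_lim_le_liminf_eLpNorm hUI.1 _ (ae_of_all _ hlim)).trans_lt ?_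
    refine (liminf_le_of_frequently_le' (Frequently.of_forall hB)).trans_lt ENNReal.coe_lt_top
  refine ⟨memLp_one_iff_integrable.1 hmem, ?_⟩
  have hL1 := tendsto_Lp_finite_of_tendsto_ae le_rfl ENNReal.one_ne_top hUI.1 hmem hUI.2.1
    (ae_of_all _ hlim)
  have hint : ∀ n, Integrable (Y n) μ := fun n => integrable_condExp.congr (hce n).symm
  have hconst : ∀ n, ∫ ω, H ω * Y n ω ∂μ = ∫ ω, H ω * X t ω ∂μ := fun n => by
    rw [← test _ (hst' n).measurableSpace_le ((hst' n).le_measurableSpace_of_const_le fun ω =>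
      WithTop.coe_le_coe.2 ((hs ω).trans (le_gridAbove (ht ω) n)))]
    refine integral_congr_ae ?_
    filter_upwards [hce n] with ω hω
    rw [hω]
  have hs' : ∫ ω, H ω * X s ω ∂μ = ∫ ω, H ω * X t ω ∂μ := by
    rw [← test _ (𝔽.le s) le_rfl]
    refine integral_congr_ae ?_
    filter_upwards [hX.condExp_ae_eq hst] with ω hω
    rw [hω]
  have hHL1 : Tendsto (fun n => eLpNorm ((fun ω => H ω * Y n ω) - fun ω => H ω * X (σ ω) ω) 1 μ)
      atTop (𝓝 0) := by
    have h0 : Tendsto (fun n => ENNReal.ofReal C * eLpNorm (Y n - fun ω => X (σ ω) ω) 1 μ)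
        atTop (𝓝 0) := by
      simpa using ENNReal.Tendsto.const_mul hL1 (Or.inr ENNReal.ofReal_ne_top)
    refine tendsto_of_tendsto_of_tendsto_of_le_of_le tendsto_const_nhds h0 (fun _ => zero_le)
      fun n => ?_
    refine eLpNorm_le_mul_eLpNorm_of_ae_le_mul (ae_of_all _ fun ω => ?_) 1
    simp only [Pi.sub_apply, ← mul_sub, norm_mul, Real.norm_eq_abs]
    exact mul_le_mul_of_nonneg_right (hC ω) (abs_nonneg _)
  have hb : ∀ f : Ω → ℝ, Integrable f μ → Integrable (fun ω => H ω * f ω) μ := fun f hf =>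
    hf.bdd_mul hHm.aestronglyMeasurable (ae_of_all _ hC)
  have := tendsto_integral_of_L1' _ (hb _ (memLp_one_iff_integrable.1 hmem)).aestronglyMeasurable
    (.of_forall fun n => hb _ (hint n)) hHL1
  simp_rw [hconst] at this
  rw [hs']
  exact tendsto_nhds_unique this tendsto_const_nhds
/-! ### The static projection problem -/

section Static

variable {P : Measure Ω} {D G : Ω → ℝ}

lemma memLp_posPart_add_mul (hD : MemLp D 2 P) (hG : MemLp G 2 P) (v : ℝ) :
    MemLp (fun ω => max (G ω + v * D ω) 0) 2 P :=
  (hG.add (hD.const_mul v)).pos_part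

lemma stronglyMeasurable_posPart_add_mul {Ω : Type*} {m : MeasurableSpace Ω} {D G : Ω → ℝ}
    (hD : StronglyMeasurable D) (hG : StronglyMeasurable G) (v : ℝ) :
    StronglyMeasurable fun ω => max (G ω + v * D ω) 0 :=
  (hG.add (hD.const_mul v)).sup stronglyMeasurable_const

lemma integrable_mul_posPart (hD : MemLp D 2 P) (hG : MemLp G 2 P) (v : ℝ) :
    Integrable (fun ω => D ω * max (G ω + v * D ω) 0) P :=
  hD.integrable_mul (memLp_posPart_add_mul hD hG v)

lemma integral_mul_posPart_mono (hD : MemLp D 2 P) (hG : MemLp G 2 P)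
    (hD0 : ∀ᵐ ω ∂P, 0 < D ω) :
    Monotone fun v : ℝ => ∫ ω, D ω * max (G ω + v * D ω) 0 ∂P := by
  intro v w hvw
  refine integral_mono_ae (integrable_mul_posPart hD hG v) (integrable_mul_posPart hD hG w) ?_
  filter_upwards [hD0] with ω hω
  have := hω.le
  gcongr

/-- The price `v ↦ E[D (G + v D)⁺]` is Lipschitz, with constant `E[D²]`. -/
lemma continuous_integral_mul_posPart (hD : MemLp D 2 P) (hG : MemLp G 2 P) :
    Continuous fun v : ℝ => ∫ ω, D ω * max (G ω + v * D ω) 0 ∂P := by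
  have hD2 : Integrable (fun ω => D ω ^ 2) P := hD.integrable_sq
  refine LipschitzWith.continuous (K := (∫ ω, D ω ^ 2 ∂P).toNNReal)
    (LipschitzWith.of_dist_le_mul fun v w => ?_)
  rw [Real.dist_eq, Real.dist_eq, Real.coe_toNNReal _ (integral_nonneg fun ω => sq_nonneg _),
    ← integral_sub (integrable_mul_posPart hD hG v) (integrable_mul_posPart hD hG w),
    ← integral_mul_const]
  refine abs_integral_le_integral_abs.trans (integral_mono_ae ?_ (hD2.mul_const _)
    (ae_of_all _ fun ω => ?_))
  · exact ((integrable_mul_posPart hD hG v).sub (integrable_mul_posPart hD hG w)).abs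
  · dsimp only
    rw [← mul_sub, abs_mul]
    have h1 := abs_max_sub_max_le_abs (G ω + v * D ω) (G ω + w * D ω) 0
    have h2 : G ω + v * D ω - (G ω + w * D ω) = (v - w) * D ω := by ring
    rw [h2, abs_mul] at h1
    calc |D ω| * _ ≤ |D ω| * (|v - w| * |D ω|) := by gcongr
      _ = |D ω| ^ 2 * |v - w| := by ring
      _ = _ := by rw [sq_abs]

lemma tendsto_integral_mul_posPart (hD : MemLp D 2 P) (hG : MemLp G 2 P)
    (hD0 : ∀ᵐ ω ∂P, 0 < D ω) :
    Tendsto (fun n : ℕ => ∫ ω, D ω * max (G ω + (-n : ℝ) * D ω) 0 ∂P) atTop (𝓝 0) := by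
  have h : Tendsto (fun n : ℕ => ∫ ω, D ω * max (G ω + (-n : ℝ) * D ω) 0 ∂P) atTop
      (𝓝 (∫ _, (0 : ℝ) ∂P)) := by
    refine tendsto_integral_of_dominated_convergence (fun ω => |D ω * G ω|)
      (fun n => (integrable_mul_posPart hD hG _).aestronglyMeasurable)
      (hD.integrable_mul hG).abs (fun n => ?_) ?_
    · filter_upwards [hD0] with ω hω
      rw [Real.norm_eq_abs, abs_mul, abs_mul]
      refine mul_le_mul_of_nonneg_left ?_ (abs_nonneg _)
      rw [abs_of_nonneg (le_max_right _ _)]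
      refine max_le ?_ (abs_nonneg _)
      have : 0 ≤ (n : ℝ) * D ω := by positivity
      linarith [le_abs_self (G ω)]
    · filter_upwards [hD0] with ω hω
      refine tendsto_const_nhds.congr' ?_
      filter_upwards [eventually_ge_atTop ⌈G ω / D ω⌉₊] with n hn
      have h1 : G ω / D ω ≤ n := Nat.ceil_le.1 hn
      rw [div_le_iff₀ hω] at h1
      rw [max_eq_right (by linarith), mul_zero]
  simpa using h

/-- The multiplier of the budget constraint exists and is unique: the price of `(G + v D)⁺` is
continuous and monotone in `v`, runs from `0` to beyond `g`, and is strictly increasing where it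
is positive. -/
lemma existsUnique_multiplier (hD : MemLp D 2 P) (hG : MemLp G 2 P)
    (hD0 : ∀ᵐ ω ∂P, 0 < D ω) (hG0 : ∀ᵐ ω ∂P, 0 ≤ G ω) {g : ℝ} (hg : 0 < g)
    (hgG : g < ∫ ω, D ω * G ω ∂P) :
    ∃! v : ℝ, ∫ ω, D ω * max (G ω + v * D ω) 0 ∂P = g := by
  set φ : ℝ → ℝ := fun v => ∫ ω, D ω * max (G ω + v * D ω) 0 ∂P with hφ
  have hφ0 : φ 0 = ∫ ω, D ω * G ω ∂P := by
    refine integral_congr_ae ?_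
    filter_upwards [hG0] with ω hω
    simp [hω]
  have hmono : Monotone φ := integral_mul_posPart_mono hD hG hD0
  -- two multipliers `a < b` with the same price force `(G + b D)⁺ = 0`
  have key : ∀ a b, a < b → φ a = g → φ b = g → False := by
    intro a b hab ha hb
    have hle : (fun ω => D ω * max (G ω + a * D ω) 0) ≤ᵐ[P]
        fun ω => D ω * max (G ω + b * D ω) 0 := by
      filter_upwards [hD0] with ω hω
      have := hω.le
      gcongr
    have heq := (integral_eq_iff_of_ae_le (integrable_mul_posPart hD hG a)
      (integrable_mul_posPart hD hG b) hle).1 (ha.trans hb.symm)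
    have hzero : φ b = 0 := by
      refine integral_eq_zero_of_ae ?_
      filter_upwards [heq, hD0] with ω h1 hω
      have h2 := mul_left_cancel₀ hω.ne' h1
      have h3 : a * D ω < b * D ω := mul_lt_mul_of_pos_right hab hω
      rcases le_or_gt (G ω + b * D ω) 0 with h | h
      · simp [max_eq_right h]
      · rw [max_eq_left h.le] at h2
        rcases max_choice (G ω + a * D ω) 0 with h4 | h4 <;> rw [h4] at h2 <;> linarith
    linarith
  obtain ⟨n, hn⟩ := ((tendsto_integral_mul_posPart hD hG hD0).eventually_lt_const hg).exists
  obtain ⟨v, -, hv⟩ := intermediate_value_Icc (f := φ) (a := -(n : ℝ)) (b := 0) (by simp)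
    (continuous_integral_mul_posPart hD hG).continuousOn ⟨hn.le, hφ0 ▸ hgG.le⟩
  refine ⟨v, hv, fun w hw => ?_⟩
  rcases lt_trichotomy w v with h | h | h
  · exact (key w v h hw hv).elim
  · exact h
  · exact (key v w h hv hw).elim

lemma multiplier_nonpos (hD : MemLp D 2 P) (hG : MemLp G 2 P)
    (hD0 : ∀ᵐ ω ∂P, 0 < D ω) (hG0 : ∀ᵐ ω ∂P, 0 ≤ G ω) {v : ℝ}
    (hv : ∫ ω, D ω * max (G ω + v * D ω) 0 ∂P < ∫ ω, D ω * G ω ∂P) : v ≤ 0 := by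
  by_contra! h
  have h0 : ∫ ω, D ω * max (G ω + 0 * D ω) 0 ∂P = ∫ ω, D ω * G ω ∂P := by
    refine integral_congr_ae ?_
    filter_upwards [hG0] with ω hω
    simp [hω]
  have := integral_mul_posPart_mono hD hG hD0 h.le
  dsimp only at this
  linarith

/-- The claim `(G + v D)⁺` is the point closest to `G` among the nonnegative claims which are not
more expensive: pointwise `((G + v D)⁺ - G) (f - (G + v D)⁺) ≥ v D (f - (G + v D)⁺)`, which is the
variational inequality for the projection. -/
lemma integral_sq_sub_posPart_le (hD : MemLp D 2 P) (hG : MemLp G 2 P) {v : ℝ} (hv : v ≤ 0)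
    {f : Ω → ℝ} (hf : MemLp f 2 P) (hf0 : ∀ᵐ ω ∂P, 0 ≤ f ω)
    (hprice : ∫ ω, D ω * f ω ∂P ≤ ∫ ω, D ω * max (G ω + v * D ω) 0 ∂P) :
    ∫ ω, (G ω - max (G ω + v * D ω) 0) ^ 2 ∂P ≤ ∫ ω, (G ω - f ω) ^ 2 ∂P := by
  have hp := memLp_posPart_add_mul hD hG v
  have i1 : Integrable (fun ω => (G ω - max (G ω + v * D ω) 0) ^ 2) P := (hG.sub hp).integrable_sq
  have i2 : Integrable (fun ω => (G ω - f ω) ^ 2) P := (hG.sub hf).integrable_sq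
  have i3 : Integrable (fun ω => D ω * f ω) P := hD.integrable_mul hf
  have i4 := integrable_mul_posPart hD hG v
  have i5 : Integrable (fun ω => 2 * v * (D ω * f ω - D ω * max (G ω + v * D ω) 0)) P :=
    (i3.sub i4).const_mul _
  have key : ∫ ω, ((G ω - max (G ω + v * D ω) 0) ^ 2 +
      2 * v * (D ω * f ω - D ω * max (G ω + v * D ω) 0)) ∂P ≤ ∫ ω, (G ω - f ω) ^ 2 ∂P := by
    refine integral_mono_ae (i1.add i5) i2 ?_
    filter_upwards [hf0] with ω hω
    rcases le_total (G ω + v * D ω) 0 with h | h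
    · rw [max_eq_right h]
      nlinarith [mul_nonneg (sub_nonneg.2 h) hω, sq_nonneg (f ω)]
    · rw [max_eq_left h]
      nlinarith [sq_nonneg (f ω - (G ω + v * D ω))]
  rw [integral_add i1 i5, integral_const_mul, integral_sub i3 i4] at key
  nlinarith [mul_nonneg_of_nonpos_of_nonpos hv (sub_nonpos.2 hprice)]

/-- Conditional expectation is an orthogonal projection. -/
lemma integral_sq_sub_eq [IsFiniteMeasure P] {m : MeasurableSpace Ω} (hm : m ≤ m0) {H f : Ω → ℝ}
    (hH : MemLp H 2 P) (hf : MemLp f 2 P) (hfm : StronglyMeasurable[m] f) :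
    ∫ ω, (H ω - f ω) ^ 2 ∂P =
      ∫ ω, (H ω - (P[H | m]) ω) ^ 2 ∂P + ∫ ω, ((P[H | m]) ω - f ω) ^ 2 ∂P := by
  have hH1 : MemLp (P[H | m]) 2 P := hH.condExp one_le_two
  set H1 := P[H | m] with hH1_def
  have hu : MemLp (H1 - f) 2 P := hH1.sub hf
  have hum : StronglyMeasurable[m] (H1 - f) := stronglyMeasurable_condExp.sub hfm
  have hpull := condExp_mul_of_stronglyMeasurable_left hum (hu.integrable_mul hH)
    (hH.integrable one_le_two)
  have hcross : ∫ ω, (H1 - f) ω * H ω ∂P = ∫ ω, (H1 - f) ω * H1 ω ∂P := by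
    rw [← integral_condExp (f := fun ω => (H1 - f) ω * H ω) hm]
    exact integral_congr_ae hpull
  have i1 : Integrable (fun ω => (H ω - H1 ω) ^ 2) P := (hH.sub hH1).integrable_sq
  have i2 : Integrable (fun ω => (H1 ω - f ω) ^ 2) P := (hH1.sub hf).integrable_sq
  have i3 : Integrable (fun ω => (H1 - f) ω * H ω) P := hu.integrable_mul hH
  have i4 : Integrable (fun ω => (H1 - f) ω * H1 ω) P := hu.integrable_mul hH1
  have : ∀ ω, (H ω - f ω) ^ 2 = ((H ω - H1 ω) ^ 2 + (H1 ω - f ω) ^ 2) +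
      2 * ((H1 - f) ω * H ω - (H1 - f) ω * H1 ω) := fun ω => by
    simp only [Pi.sub_apply]; ring
  simp_rw [this]
  have i5 : Integrable (fun ω => (H ω - H1 ω) ^ 2 + (H1 ω - f ω) ^ 2) P := i1.add i2
  have i6 : Integrable (fun ω => 2 * ((H1 - f) ω * H ω - (H1 - f) ω * H1 ω)) P :=
    (i3.sub i4).const_mul 2
  rw [integral_add i5 i6, integral_add i1 i2, integral_const_mul, integral_sub i3 i4, hcross,
    sub_self, mul_zero, add_zero]

lemma enorm_sq_eq_ofReal (a : ℝ) : ‖a‖ₑ ^ 2 = ENNReal.ofReal (a ^ 2) := by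
  rw [← sq_abs, ENNReal.ofReal_pow (abs_nonneg _), ← Real.enorm_eq_ofReal_abs]

lemma lintegral_enorm_sq_eq {f : Ω → ℝ} (hf : MemLp f 2 P) :
    ∫⁻ ω, ‖f ω‖ₑ ^ 2 ∂P = ENNReal.ofReal (∫ ω, f ω ^ 2 ∂P) := by
  rw [ofReal_integral_eq_lintegral_ofReal hf.integrable_sq (ae_of_all _ fun ω => sq_nonneg _)]
  exact lintegral_congr fun ω => enorm_sq_eq_ofReal _

lemma memLp_two_of_lintegral {f : Ω → ℝ} (hf : AEStronglyMeasurable f P)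
    (h : ∫⁻ ω, ‖f ω‖ₑ ^ 2 ∂P < ∞) : MemLp f 2 P := by
  refine ⟨hf, ?_⟩
  rw [eLpNorm_lt_top_iff_lintegral_rpow_enorm_lt_top two_ne_zero ENNReal.ofNat_ne_top]
  simpa using h

end Static

/-! ### Change of measure on the observable information -/

namespace Market

variable (M : Market Ω)

instance : IsProbabilityMeasure M.P := M.prob_P

instance : IsProbabilityMeasure M.Pt := M.prob_Pt

lemma trim_Pt_ac : M.Pt.trim (M.obs.le M.T) ≪ M.P.trim (M.obs.le M.T) := M.Pt_ac.trim _

lemma stronglyMeasurable_D : StronglyMeasurable[M.obs M.T] M.D :=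
  (Measure.measurable_rnDeriv _ _).ennreal_toReal.stronglyMeasurable

lemma memLp_D : MemLp M.D 2 M.P := M.memLp_density

lemma D_pos : ∀ᵐ ω ∂M.P, 0 < M.D ω := by
  refine M.P_ac.ae_le (ae_of_ae_trim (M.obs.le M.T) ?_)
  filter_upwards [Measure.rnDeriv_pos M.trim_Pt_ac,
    M.trim_Pt_ac.ae_le (Measure.rnDeriv_lt_top (M.Pt.trim (M.obs.le M.T)) (M.P.trim (M.obs.le M.T)))]
    with ω h1 h2
  exact ENNReal.toReal_pos h1.ne' h2.ne

lemma integral_Pt {f : Ω → ℝ} (hf : StronglyMeasurable[M.obs M.T] f) :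
    ∫ ω, f ω ∂M.Pt = ∫ ω, M.D ω * f ω ∂M.P := by
  rw [integral_trim (M.obs.le M.T) hf, ← integral_toReal_rnDeriv_mul M.trim_Pt_ac,
    integral_trim (f := fun ω => M.D ω * f ω) (M.obs.le M.T) (M.stronglyMeasurable_D.mul hf)]
  rfl

lemma lintegral_Pt {f : Ω → ℝ≥0∞} (hf : Measurable[M.obs M.T] f) :
    ∫⁻ ω, f ω ∂M.Pt = ∫⁻ ω, ‖M.D ω‖ₑ * f ω ∂M.P := by
  rw [← lintegral_trim (M.obs.le M.T) hf, ← lintegral_rnDeriv_mul M.trim_Pt_ac hf.aemeasurable,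
    ← lintegral_trim (f := fun ω => ‖M.D ω‖ₑ * f ω) (M.obs.le M.T)
      ((measurable_enorm.comp M.stronglyMeasurable_D.measurable).mul hf)]
  refine lintegral_congr_ae ?_
  filter_upwards [Measure.rnDeriv_lt_top (M.Pt.trim (M.obs.le M.T)) (M.P.trim (M.obs.le M.T))]
    with ω h
  change _ = ‖(_ : ℝ≥0∞).toReal‖ₑ * _
  rw [Real.enorm_of_nonneg ENNReal.toReal_nonneg, ENNReal.ofReal_toReal h.ne]

/-- As the density is square-integrable, `L²(P)`-convergence implies `L¹(P̃)`-convergence for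
observable random variables. -/
lemma lintegral_enorm_Pt_le {f : Ω → ℝ} (hf : StronglyMeasurable[M.obs M.T] f) :
    ∫⁻ ω, ‖f ω‖ₑ ∂M.Pt ≤
      (∫⁻ ω, ‖M.D ω‖ₑ ^ 2 ∂M.P) ^ (1 / 2 : ℝ) * (∫⁻ ω, ‖f ω‖ₑ ^ 2 ∂M.P) ^ (1 / 2 : ℝ) := by
  rw [M.lintegral_Pt (f := fun ω => ‖f ω‖ₑ) (measurable_enorm.comp hf.measurable)]
  have h := ENNReal.lintegral_mul_le_Lp_mul_Lq M.P Real.HolderConjugate.two_two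
    (M.memLp_D.1.enorm) ((hf.mono (M.obs.le M.T)).aestronglyMeasurable (μ := M.P)).enorm
  simpa using h

lemma integrable_Pt {f : Ω → ℝ} (hf : StronglyMeasurable[M.obs M.T] f) (hf2 : MemLp f 2 M.P) :
    Integrable f M.Pt := by
  refine ⟨(hf.mono (M.obs.le M.T)).aestronglyMeasurable, (M.lintegral_enorm_Pt_le hf).trans_lt ?_⟩
  rw [lintegral_enorm_sq_eq hf2, lintegral_enorm_sq_eq M.memLp_D]
  exact ENNReal.mul_lt_top (ENNReal.rpow_lt_top_of_nonneg (by norm_num) ENNReal.ofReal_ne_top)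
    (ENNReal.rpow_lt_top_of_nonneg (by norm_num) ENNReal.ofReal_ne_top)

end Market

/-! ### Elementary integrals -/

lemma IsCadlag.rightContinuous {f : ℝ≥0 → ℝ} (hf : IsCadlag f) (t : ℝ≥0) :
    ContinuousWithinAt f (Set.Ici t) t := (hf t).1

lemma IsCadlag.add {f g : ℝ≥0 → ℝ} (hf : IsCadlag f) (hg : IsCadlag g) :
    IsCadlag fun t => f t + g t := fun t => by
  obtain ⟨a, ha⟩ := (hf t).2
  obtain ⟨b, hb⟩ := (hg t).2
  exact ⟨(hf t).1.add (hg t).1, a + b, ha.add hb⟩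

/-- Stopping a path at a fixed time preserves right-continuity. -/
lemma continuousWithinAt_min_const {f : ℝ≥0 → ℝ}
    (hf : ∀ t, ContinuousWithinAt f (Set.Ici t) t) (a t : ℝ≥0) :
    ContinuousWithinAt (fun s => f (min a s)) (Set.Ici t) t :=
  (hf (min a t)).comp (continuous_const.min continuous_id).continuousWithinAt
    fun _ hs => min_le_min_left a hs

namespace SimpleStrategy

variable {𝔽 : Filtration ℝ≥0 m0} {S : ℝ≥0 → Ω → ℝ}

lemma rightContinuous_integral (θ : SimpleStrategy 𝔽)
    (hS : ∀ ω t, ContinuousWithinAt (fun s => S s ω) (Set.Ici t) t) (ω : Ω) (t : ℝ≥0) :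
    ContinuousWithinAt (fun s => θ.integral S s ω) (Set.Ici t) t := by
  unfold SimpleStrategy.integral
  exact tendsto_finsetSum _ fun i _ => ((continuousWithinAt_min_const (hS ω) (θ.t i) t).sub
    (continuousWithinAt_min_const (hS ω) (θ.s i) t)).const_mul (θ.H i ω)

lemma stronglyAdapted_integral (θ : SimpleStrategy 𝔽) (hS : StronglyAdapted 𝔽 S) :
    StronglyAdapted 𝔽 (θ.integral S) := by
  intro u
  unfold SimpleStrategy.integral
  refine Finset.stronglyMeasurable_fun_sum _ fun i _ => ?_
  rcases le_total (θ.s i) u with h | h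
  · exact ((θ.measurable_H i).mono (𝔽.mono h)).mul
      (((hS _).mono (𝔽.mono (min_le_right _ _))).sub ((hS _).mono (𝔽.mono (min_le_right _ _))))
  · -- a position opened after time `u` has not gained anything yet
    simp only [min_eq_right h, min_eq_right (h.trans (θ.s_le_t i)), sub_self, mul_zero]
    exact stronglyMeasurable_const

/-- Elementary integrals with respect to a martingale have mean zero at bounded stopping times. -/
lemma integral_stopped {μ : Measure Ω} [IsProbabilityMeasure μ] {T : ℝ≥0}
    (θ : SimpleStrategy 𝔽) (hS : MartingaleOn T S 𝔽 μ)
    (hc : ∀ ω t, ContinuousWithinAt (fun s => S s ω) (Set.Ici t) t)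
    {ρ : Ω → ℝ≥0} (hρ : IsStoppingTime 𝔽 fun ω => (ρ ω : WithTop ℝ≥0)) (hρT : ∀ ω, ρ ω ≤ T) :
    Integrable (fun ω => θ.integral S (ρ ω) ω) μ ∧ ∫ ω, θ.integral S (ρ ω) ω ∂μ = 0 := by
  unfold MartingaleOn at hS
  set X : ℝ≥0 → Ω → ℝ := fun t => S (min t T) with hX
  have hXc : ∀ ω t, ContinuousWithinAt (fun s => X s ω) (Set.Ici t) t := fun ω t => by
    simp only [hX, min_comm _ T]
    exact continuousWithinAt_min_const (hc ω) T t
  obtain ⟨C, hC⟩ := θ.bounded_H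
  -- the increment over `(s ∧ ρ, t ∧ ρ]` is the one over `(s, σ]`, with `σ = s ∨ (t ∧ ρ)`
  have hinc : ∀ i ω, S (min (θ.t i) (ρ ω)) ω - S (min (θ.s i) (ρ ω)) ω =
      X (max (θ.s i) (min (θ.t i) (ρ ω))) ω - X (θ.s i) ω := by
    intro i ω
    have hst := θ.s_le_t i
    have hT := hρT ω
    rcases le_total (ρ ω) (θ.s i) with h | h
    · rw [min_eq_right h, min_eq_right (h.trans hst), max_eq_left h, sub_self, sub_self]
    · rw [min_eq_left h, max_eq_right (le_min hst h)]
      simp only [hX]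
      rw [min_eq_left (h.trans hT), min_eq_left ((min_le_right _ _).trans hT)]
  have hterm : ∀ i, Integrable
      (fun ω => θ.H i ω * (S (min (θ.t i) (ρ ω)) ω - S (min (θ.s i) (ρ ω)) ω)) μ ∧
      ∫ ω, θ.H i ω * (S (min (θ.t i) (ρ ω)) ω - S (min (θ.s i) (ρ ω)) ω) ∂μ = 0 := by
    intro i
    simp only [hinc]
    have hσ : IsStoppingTime 𝔽
        fun ω => ((max (θ.s i) (min (θ.t i) (ρ ω)) : ℝ≥0) : WithTop ℝ≥0) := by
      simpa only [WithTop.coe_max, WithTop.coe_min, max_comm, min_comm] using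
        (hρ.min_const (θ.t i)).max_const (θ.s i)
    obtain ⟨h1, h2⟩ := optional_sampling hS hXc hσ (fun ω => le_max_left _ _)
      (fun ω => max_le (θ.s_le_t i) (min_le_left _ _)) (θ.measurable_H i) (hC i)
    have hm := ((θ.measurable_H i).mono (𝔽.le _)).aestronglyMeasurable (μ := μ)
    have i1 := h1.bdd_mul hm (ae_of_all _ (hC i))
    have i2 := (hS.integrable (θ.s i)).bdd_mul hm (ae_of_all _ (hC i))
    simp only [mul_sub]
    exact ⟨i1.sub i2, by rw [integral_sub i1 i2, h2, sub_self]⟩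
  unfold SimpleStrategy.integral
  refine ⟨integrable_finsetSum _ fun i _ => (hterm i).1, ?_⟩
  rw [integral_finsetSum _ fun i _ => (hterm i).1]
  exact Finset.sum_eq_zero fun i _ => (hterm i).2

end SimpleStrategy

/-! ### The budget inequality -/

namespace Market

variable {M : Market Ω} {ξ X : ℝ≥0 → Ω → ℝ}

/-- A gains process stopped at one of its localizing times has mean zero under the martingale
measure, being the `L¹(P̃)`-limit of elementary integrals. -/
lemma integral_stopped_eq_zero (had : StronglyAdapted M.obs X) (hX : ∀ ω, IsCadlag fun t => X t ω)
    {θ : ℕ → SimpleStrategy M.obs} {τ : Ω → WithTop ℝ≥0} (hτ : IsStoppingTime M.obs τ)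
    (hlim : Tendsto (fun n => ∫⁻ ω, (⨆ (t : ℝ≥0) (_ : t ≤ M.T ∧ (t : WithTop ℝ≥0) ≤ τ ω),
        ‖(θ n).integral M.S t ω - X t ω‖ₑ ^ 2) ∂M.P) atTop (𝓝 0)) :
    Integrable (fun ω => X (truncate M.T τ ω) ω) M.Pt ∧
      ∫ ω, X (truncate M.T τ ω) ω ∂M.Pt = 0 := by
  set ρ := truncate M.T τ with hρ_def
  have hρ := isStoppingTime_truncate hτ M.T
  have hρT : ∀ ω, ρ ω ≤ M.T := truncate_le M.T τ
  have hρτ : ∀ ω, (ρ ω : WithTop ℝ≥0) ≤ τ ω := fun ω => by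
    rw [hρ_def, coe_truncate]; exact min_le_left _ _
  have hSc : ∀ ω t, ContinuousWithinAt (fun s => M.S s ω) (Set.Ici t) t :=
    fun ω => (M.cadlag_S ω).rightContinuous
  set I : ℕ → Ω → ℝ := fun n ω => (θ n).integral M.S (ρ ω) ω with hI
  have hI0 : ∀ n, Integrable (I n) M.Pt ∧ ∫ ω, I n ω ∂M.Pt = 0 := fun n =>
    (θ n).integral_stopped M.martingale_S hSc hρ hρT
  set Z : ℕ → Ω → ℝ := fun n ω => I n ω - X (ρ ω) ω with hZ
  have hZm : ∀ n, StronglyMeasurable[M.obs M.T] (Z n) := fun n =>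
    stronglyMeasurable_sample (m := M.obs M.T)
      (X := fun t ω => (θ n).integral M.S t ω - X t ω)
      (fun s hs => (((θ n).stronglyAdapted_integral M.adapted_S s).sub (had s)).mono
        (M.obs.mono hs))
      (fun ω s => ((θ n).rightContinuous_integral hSc ω s).sub ((hX ω).rightContinuous s))
      (measurable_of_isStoppingTime hρ hρT) hρT
  have hZ2 : Tendsto (fun n => ∫⁻ ω, ‖Z n ω‖ₑ ^ 2 ∂M.P) atTop (𝓝 0) :=
    tendsto_of_tendsto_of_tendsto_of_le_of_le tendsto_const_nhds hlim (fun _ => zero_le)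
      fun n => lintegral_mono fun ω =>
        le_iSup₂ (f := fun (t : ℝ≥0) (_ : t ≤ M.T ∧ (t : WithTop ℝ≥0) ≤ τ ω) =>
          ‖(θ n).integral M.S t ω - X t ω‖ₑ ^ 2) (ρ ω) ⟨hρT ω, hρτ ω⟩
  have hZ1 : Tendsto (fun n => ∫⁻ ω, ‖Z n ω‖ₑ ∂M.Pt) atTop (𝓝 0) := by
    refine tendsto_of_tendsto_of_tendsto_of_le_of_le tendsto_const_nhds ?_ (fun _ => zero_le)
      fun n => M.lintegral_enorm_Pt_le (hZm n)
    have h1 : Tendsto (fun n => (∫⁻ ω, ‖Z n ω‖ₑ ^ 2 ∂M.P) ^ (1 / 2 : ℝ)) atTop (𝓝 0) := by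
      simpa using hZ2.ennrpow_const (1 / 2 : ℝ)
    have h2 : (∫⁻ ω, ‖M.D ω‖ₑ ^ 2 ∂M.P) ^ (1 / 2 : ℝ) ≠ ∞ := by
      rw [lintegral_enorm_sq_eq M.memLp_D]
      exact (ENNReal.rpow_lt_top_of_nonneg (by norm_num) ENNReal.ofReal_ne_top).ne
    simpa using ENNReal.Tendsto.const_mul h1 (Or.inr h2)
  have hZint : ∀ᶠ n in atTop, Integrable (Z n) M.Pt := by
    filter_upwards [hZ1.eventually_lt_const ENNReal.zero_lt_top] with n hn
    exact ⟨((hZm n).mono (M.obs.le M.T)).aestronglyMeasurable, hn⟩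
  have hXeq : ∀ n, (fun ω => X (ρ ω) ω) = fun ω => I n ω - Z n ω := fun n => by
    ext ω; simp [hZ]
  have hXint : Integrable (fun ω => X (ρ ω) ω) M.Pt := by
    obtain ⟨n, hn⟩ := hZint.exists
    rw [hXeq n]
    exact (hI0 n).1.sub hn
  refine ⟨hXint, ?_⟩
  have hle : ∀ᶠ n in atTop, ‖∫ ω, X (ρ ω) ω ∂M.Pt‖ₑ ≤ ∫⁻ ω, ‖Z n ω‖ₑ ∂M.Pt := by
    filter_upwards [hZint] with n hn
    rw [hXeq n, integral_sub (hI0 n).1 hn, (hI0 n).2, zero_sub, enorm_neg]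
    exact enorm_integral_le_lintegral_enorm _
  have := ge_of_tendsto hZ1 hle
  simpa using this

/-- The budget inequality: a nonnegative wealth process is a local martingale under the martingale
measure, so by Fatou's lemma the mean of its terminal value is at most the initial capital. -/
lemma integral_terminal_le (hX : M.IsStochasticIntegral ξ X) {x : ℝ}
    (hx : ∀ᵐ ω ∂M.P, ∀ t ≤ M.T, 0 ≤ x + X t ω) (hint : Integrable (X M.T) M.Pt) :
    ∫ ω, (x + X M.T ω) ∂M.Pt ≤ x := by
  obtain ⟨θ, τ, hτ, -, hlim⟩ := hX.approx
  set ρ : ℕ → Ω → ℝ≥0 := fun k => truncate M.T (τ k) with hρ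
  have h0 := fun k => integral_stopped_eq_zero hX.adapted hX.cadlag (hτ.isStoppingTime k) (hlim k)
  have hx' : ∀ᵐ ω ∂M.Pt, ∀ t ≤ M.T, 0 ≤ x + X t ω := M.Pt_ac.ae_le hx
  have hmean : ∀ k, ∫ ω, (x + X (ρ k ω) ω) ∂M.Pt = x := fun k => by
    rw [integral_add (integrable_const x) (h0 k).1, (h0 k).2]
    simp
  have hnn : ∀ k, 0 ≤ᵐ[M.Pt] fun ω => x + X (ρ k ω) ω := fun k => by
    filter_upwards [hx'] with ω hω using hω _ (truncate_le _ _ _)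
  have hx0 : 0 ≤ x := by
    rw [← hmean 0]
    exact integral_nonneg_of_ae (hnn 0)
  have hconv : ∀ᵐ ω ∂M.Pt, Tendsto (fun k => ENNReal.ofReal (x + X (ρ k ω) ω)) atTop
      (𝓝 (ENNReal.ofReal (x + X M.T ω))) := by
    filter_upwards [M.Pt_ac.ae_le hτ.tendsto_top] with ω hω
    refine tendsto_const_nhds.congr' ?_
    filter_upwards [hω.eventually (lt_mem_nhds (WithTop.coe_lt_top M.T))] with k hk
    have : ρ k ω = M.T := by
      rw [← WithTop.coe_inj, hρ, coe_truncate, min_eq_right hk.le]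
    rw [this]
  have hfatou : ∫⁻ ω, ENNReal.ofReal (x + X M.T ω) ∂M.Pt ≤ ENNReal.ofReal x := by
    calc ∫⁻ ω, ENNReal.ofReal (x + X M.T ω) ∂M.Pt
        = ∫⁻ ω, liminf (fun k => ENNReal.ofReal (x + X (ρ k ω) ω)) atTop ∂M.Pt := by
          refine lintegral_congr_ae ?_
          filter_upwards [hconv] with ω hω using hω.liminf_eq.symm
      _ ≤ liminf (fun k => ∫⁻ ω, ENNReal.ofReal (x + X (ρ k ω) ω) ∂M.Pt) atTop :=
          lintegral_liminf_le' fun k =>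
            ((h0 k).1.aestronglyMeasurable.aemeasurable.const_add x).ennreal_ofReal
      _ = ENNReal.ofReal x := by
          have : ∀ k, ∫⁻ ω, ENNReal.ofReal (x + X (ρ k ω) ω) ∂M.Pt = ENNReal.ofReal x :=
            fun k => by
              have hi : Integrable (fun ω => x + X (ρ k ω) ω) M.Pt :=
                (integrable_const x).add (h0 k).1
              rw [← ofReal_integral_eq_lintegral_ofReal hi (hnn k), hmean k]
          simp_rw [this]
          exact tendsto_const_nhds.liminf_eq
  have hnnT : 0 ≤ᵐ[M.Pt] fun ω => x + X M.T ω := by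
    filter_upwards [hx'] with ω hω using hω _ le_rfl
  have hi : Integrable (fun ω => x + X M.T ω) M.Pt := (integrable_const x).add hint
  rw [← ofReal_integral_eq_lintegral_ofReal hi hnnT] at hfatou
  exact (ENNReal.ofReal_le_ofReal_iff hx0).1 hfatou

end Market

/-! ### Additivity of the stochastic integral -/

lemma enorm_add_sq_le (a b : ℝ) : ‖a + b‖ₑ ^ 2 ≤ 2 * ‖a‖ₑ ^ 2 + 2 * ‖b‖ₑ ^ 2 := by
  simp only [enorm_sq_eq_ofReal]
  rw [← ENNReal.ofReal_ofNat 2, ← ENNReal.ofReal_mul zero_le_two, ← ENNReal.ofReal_mul zero_le_two,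
    ← ENNReal.ofReal_add (by positivity) (by positivity)]
  exact ENNReal.ofReal_le_ofReal (by nlinarith [sq_nonneg (a - b)])

lemma measurable_path_of_predictable {𝔽 : Filtration ℝ≥0 m0} {ξ : ℝ≥0 → Ω → ℝ}
    (hξ : IsStronglyPredictable 𝔽 ξ) (ω : Ω) : Measurable fun t => ξ t ω := by
  have hle : 𝔽.predictable ≤ (inferInstance : MeasurableSpace (ℝ≥0 × Ω)) :=
    measurableSpace_le_predictable_of_measurableSet
      (fun A hA => (measurableSet_singleton _).prod (𝔽.le _ A hA))
      (fun i A hA => measurableSet_Ioi.prod (𝔽.le i A hA))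
  have h : Measurable (Function.uncurry ξ) := (StronglyMeasurable.mono hξ hle).measurable
  exact h.comp measurable_prodMk_right

/-- The running supremum of a right-continuous process up to a bounded random time is measurable,
being a supremum over grid points. -/
lemma measurable_iSup_path {W : ℝ≥0 → Ω → ℝ} (hW : ∀ s, StronglyMeasurable (W s))
    (hc : ∀ ω s, ContinuousWithinAt (fun s => W s ω) (Set.Ici s) s) {ρ : Ω → ℝ≥0} {T : ℝ≥0}
    (hρ : Measurable ρ) (hρT : ∀ ω, ρ ω ≤ T) :
    Measurable fun ω => ⨆ (t : ℝ≥0) (_ : t ≤ ρ ω), ‖W t ω‖ₑ ^ 2 := by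
  have heq : (fun ω => ⨆ (t : ℝ≥0) (_ : t ≤ ρ ω), ‖W t ω‖ₑ ^ 2) = fun ω =>
      ⨆ p : ℕ × ℕ, ‖W (min (ρ ω) ((p.1 + 1) / ((p.2 : ℝ≥0) + 1))) ω‖ₑ ^ 2 := by
    ext ω
    refine le_antisymm (iSup₂_le fun t ht => ?_) (iSup_le fun p =>
      le_iSup₂ (f := fun (t : ℝ≥0) (_ : t ≤ ρ ω) => ‖W t ω‖ₑ ^ 2) _ (min_le_left _ _))
    have h1 : Tendsto (fun n => ‖W (gridAbove (ρ ω) n t) ω‖ₑ ^ 2) atTop (𝓝 (‖W t ω‖ₑ ^ 2)) :=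
      ((ENNReal.continuous_pow 2).tendsto _).comp
        ((hc ω t).enorm.tendsto.comp (tendsto_gridAbove ht))
    exact le_of_tendsto' h1 fun n =>
      le_iSup (fun p : ℕ × ℕ => ‖W (min (ρ ω) ((p.1 + 1) / ((p.2 : ℝ≥0) + 1))) ω‖ₑ ^ 2)
        (⌊((n : ℝ≥0) + 1) * t⌋₊, n)
  rw [heq]
  refine Measurable.iSup fun p => ?_
  have h2 : StronglyMeasurable fun ω => W (min (ρ ω) ((p.1 + 1) / ((p.2 : ℝ≥0) + 1))) ω :=
    stronglyMeasurable_sample (ρ := fun ω => min (ρ ω) ((p.1 + 1) / ((p.2 : ℝ≥0) + 1)))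
      (fun s _ => hW s) hc (hρ.min measurable_const) fun ω => (min_le_left _ _).trans (hρT ω)
  exact h2.measurable.enorm.pow_const 2

namespace SimpleStrategy

variable {𝔽 : Filtration ℝ≥0 m0}

/-- The sum of two simple strategies, as the concatenation of their lists of positions. -/
def add (θ κ : SimpleStrategy 𝔽) : SimpleStrategy 𝔽 where
  n := θ.n + κ.n
  s := Fin.append θ.s κ.s
  t := Fin.append θ.t κ.t
  s_le_t := Fin.addCases (by simpa using θ.s_le_t) (by simpa using κ.s_le_t)
  H := Fin.append θ.H κ.H
  measurable_H := Fin.addCases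
    (fun i => by rw [Fin.append_left, Fin.append_left]; exact θ.measurable_H i)
    (fun i => by rw [Fin.append_right, Fin.append_right]; exact κ.measurable_H i)
  bounded_H := by
    obtain ⟨a, ha⟩ := θ.bounded_H
    obtain ⟨b, hb⟩ := κ.bounded_H
    refine ⟨max a b, Fin.addCases (fun i ω => ?_) (fun i ω => ?_)⟩
    · rw [Fin.append_left]; exact (ha i ω).trans (le_max_left _ _)
    · rw [Fin.append_right]; exact (hb i ω).trans (le_max_right _ _)

lemma val_add (θ κ : SimpleStrategy 𝔽) (u : ℝ≥0) (ω : Ω) :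
    (θ.add κ).val u ω = θ.val u ω + κ.val u ω := by
  change ∑ i : Fin (θ.n + κ.n), (Set.Ioc (Fin.append θ.s κ.s i) (Fin.append θ.t κ.t i)).indicator
    (fun _ => Fin.append θ.H κ.H i ω) u = _
  simp only [val, Fin.sum_univ_add, Fin.append_left, Fin.append_right]

lemma integral_add (θ κ : SimpleStrategy 𝔽) (S : ℝ≥0 → Ω → ℝ) (u : ℝ≥0) (ω : Ω) :
    (θ.add κ).integral S u ω = θ.integral S u ω + κ.integral S u ω := by
  change ∑ i : Fin (θ.n + κ.n), Fin.append θ.H κ.H i ω *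
    (S (min (Fin.append θ.t κ.t i) u) ω - S (min (Fin.append θ.s κ.s i) u) ω) = _
  simp only [SimpleStrategy.integral, Fin.sum_univ_add, Fin.append_left, Fin.append_right]

lemma measurable_val (θ : SimpleStrategy 𝔽) (ω : Ω) : Measurable fun u => θ.val u ω :=
  Finset.measurable_fun_sum _ fun _ _ => measurable_const.indicator measurableSet_Ioc

end SimpleStrategy

namespace Market

variable {M : Market Ω} {ξ η X Y : ℝ≥0 → Ω → ℝ}

lemma size_add_le {a b : ℝ≥0 → Ω → ℝ} {ω : Ω} (ha : Measurable fun t => a t ω)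
    (hb : Measurable fun t => b t ω) :
    M.size (fun t ω => a t ω + b t ω) ω ≤ 2 * (M.size a ω + M.size b ω) := by
  have h1 : ∫⁻ t in Set.Ioc 0 M.T, ‖a t ω + b t ω‖ₑ ^ 2 ∂(M.dQ ω) ≤
      2 * ∫⁻ t in Set.Ioc 0 M.T, ‖a t ω‖ₑ ^ 2 ∂(M.dQ ω) +
      2 * ∫⁻ t in Set.Ioc 0 M.T, ‖b t ω‖ₑ ^ 2 ∂(M.dQ ω) := by
    rw [← lintegral_const_mul _ (ha.enorm.pow_const 2), ← lintegral_const_mul _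
      (hb.enorm.pow_const 2), ← lintegral_add_left ((ha.enorm.pow_const 2).const_mul 2)]
    exact lintegral_mono fun t => enorm_add_sq_le _ _
  have h2 : ∫⁻ t in Set.Ioc 0 M.T, ‖a t ω + b t ω‖ₑ ∂(M.dV ω) ≤
      2 * ∫⁻ t in Set.Ioc 0 M.T, ‖a t ω‖ₑ ∂(M.dV ω) +
      2 * ∫⁻ t in Set.Ioc 0 M.T, ‖b t ω‖ₑ ∂(M.dV ω) := by
    calc _ ≤ ∫⁻ t in Set.Ioc 0 M.T, ‖a t ω‖ₑ ∂(M.dV ω) +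
          ∫⁻ t in Set.Ioc 0 M.T, ‖b t ω‖ₑ ∂(M.dV ω) := by
          rw [← lintegral_add_left ha.enorm]
          exact lintegral_mono fun t => enorm_add_le _ _
      _ ≤ _ := by
          gcongr <;> exact le_mul_of_one_le_left zero_le one_le_two
  refine (add_le_add h1 h2).trans_eq ?_
  simp only [size]
  ring

/-- Simple strategies which converge to `ξ` and to `η` add up to simple strategies which converge
to `ξ + η`, and the pointwise minimum of two localizing sequences localizes both integrals. -/
lemma IsStochasticIntegral.add (hξ : IsStronglyPredictable M.obs ξ)
    (hη : IsStronglyPredictable M.obs η) (hX : M.IsStochasticIntegral ξ X)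
    (hY : M.IsStochasticIntegral η Y) :
    M.IsStochasticIntegral (fun t ω => ξ t ω + η t ω) (fun t ω => X t ω + Y t ω) := by
  refine ⟨fun t => (hX.adapted t).add (hY.adapted t), fun ω => (hX.cadlag ω).add (hY.cadlag ω), ?_⟩
  obtain ⟨θ, τ, hτ, hsθ, hθ⟩ := hX.approx
  obtain ⟨κ, σ, hσ, hsκ, hκ⟩ := hY.approx
  refine ⟨fun n => (θ n).add (κ n), min τ σ, hτ.min hσ, fun ε hε => ?_, fun k => ?_⟩
  · have hε4 : 0 < ε / 4 := ENNReal.div_pos hε.ne' (by simp)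
    have h0 := (hsθ _ hε4).add (hsκ _ hε4)
    rw [add_zero] at h0
    refine tendsto_of_tendsto_of_tendsto_of_le_of_le tendsto_const_nhds h0 (fun _ => zero_le)
      fun n => (measure_mono fun ω hω => ?_).trans (measure_union_le _ _)
    have hle : M.size (fun t ω => ((θ n).add (κ n)).val t ω - (ξ t ω + η t ω)) ω ≤
        2 * (M.size (fun t ω => (θ n).val t ω - ξ t ω) ω +
          M.size (fun t ω => (κ n).val t ω - η t ω) ω) := by
      simp only [SimpleStrategy.val_add, add_sub_add_comm]
      exact size_add_le (((θ n).measurable_val ω).sub (measurable_path_of_predictable hξ ω))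
        (((κ n).measurable_val ω).sub (measurable_path_of_predictable hη ω))
    have h4 : ε ≤ 4 * max (M.size (fun t ω => (θ n).val t ω - ξ t ω) ω)
        (M.size (fun t ω => (κ n).val t ω - η t ω) ω) := by
      refine (le_trans hω hle).trans ?_
      rw [show (4 : ℝ≥0∞) = 2 * 2 by norm_num, mul_assoc, two_mul (max _ _)]
      gcongr
      exacts [le_max_left _ _, le_max_right _ _]
    exact le_max_iff.1 (ENNReal.div_le_of_le_mul' h4)
  · have hSc : ∀ ω t, ContinuousWithinAt (fun s => M.S s ω) (Set.Ici t) t :=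
      fun ω => (M.cadlag_S ω).rightContinuous
    have hmeas : ∀ n, Measurable fun ω => ⨆ (t : ℝ≥0) (_ : t ≤ M.T ∧ (t : WithTop ℝ≥0) ≤ τ k ω),
        ‖(θ n).integral M.S t ω - X t ω‖ₑ ^ 2 := by
      intro n
      have hiff : ∀ (t : ℝ≥0) ω, (t ≤ M.T ∧ (t : WithTop ℝ≥0) ≤ τ k ω) ↔
          t ≤ truncate M.T (τ k) ω := fun t ω => by
        rw [← WithTop.coe_le_coe (a := truncate M.T (τ k) ω), coe_truncate, le_min_iff,
          WithTop.coe_le_coe, and_comm]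
      simp only [hiff]
      refine measurable_iSup_path (W := fun t ω => (θ n).integral M.S t ω - X t ω)
        (fun s => (((θ n).stronglyAdapted_integral M.adapted_S s).sub (hX.adapted s)).mono
          (M.obs.le s))
        (fun ω s => ((θ n).rightContinuous_integral hSc ω s).sub ((hX.cadlag ω).rightContinuous s))
        ((measurable_of_isStoppingTime (isStoppingTime_truncate (hτ.isStoppingTime k) M.T)
          (truncate_le M.T (τ k))).mono (M.obs.le M.T) le_rfl) (truncate_le M.T (τ k))
    have h0 := (ENNReal.Tendsto.const_mul (a := 2) (hθ k) (Or.inr ENNReal.ofNat_ne_top)).add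
      (ENNReal.Tendsto.const_mul (a := 2) (hκ k) (Or.inr ENNReal.ofNat_ne_top))
    rw [mul_zero, add_zero] at h0
    refine tendsto_of_tendsto_of_tendsto_of_le_of_le tendsto_const_nhds h0 (fun _ => zero_le)
      fun n => ?_
    dsimp only
    rw [← lintegral_const_mul _ (hmeas n), ← lintegral_const_mul' _ _ ENNReal.ofNat_ne_top,
      ← lintegral_add_left ((hmeas n).const_mul 2)]
    refine lintegral_mono fun ω => iSup₂_le fun t ht => ?_
    obtain ⟨htT, ht⟩ := ht
    have ht' : (t : WithTop ℝ≥0) ≤ min (τ k ω) (σ k ω) := ht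
    rw [SimpleStrategy.integral_add, add_sub_add_comm]
    refine (enorm_add_sq_le _ _).trans ?_
    gcongr
    · exact le_iSup₂ (f := fun (t : ℝ≥0) (_ : t ≤ M.T ∧ (t : WithTop ℝ≥0) ≤ τ k ω) =>
        ‖(θ n).integral M.S t ω - X t ω‖ₑ ^ 2) t ⟨htT, ht'.trans (min_le_left _ _)⟩
    · exact le_iSup₂ (f := fun (t : ℝ≥0) (_ : t ≤ M.T ∧ (t : WithTop ℝ≥0) ≤ σ k ω) =>
        ‖(κ n).integral M.S t ω - Y t ω‖ₑ ^ 2) t ⟨htT, ht'.trans (min_le_right _ _)⟩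

lemma IsStrategy.add (hξ : M.IsStrategy ξ) (hη : M.IsStrategy η) :
    M.IsStrategy fun t ω => ξ t ω + η t ω := by
  refine ⟨StronglyMeasurable.add hξ.predictable hη.predictable, ?_, ?_⟩
  · filter_upwards [hξ.sq_integrable, hη.sq_integrable] with ω h1 h2
    have hm := measurable_path_of_predictable hξ.predictable ω
    refine (lintegral_mono fun t => enorm_add_sq_le _ _).trans_lt ?_
    rw [lintegral_add_left ((hm.enorm.pow_const 2).const_mul 2),
      lintegral_const_mul' _ _ ENNReal.ofNat_ne_top, lintegral_const_mul' _ _ ENNReal.ofNat_ne_top]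
    exact ENNReal.add_lt_top.2 ⟨ENNReal.mul_lt_top (by simp) h1, ENNReal.mul_lt_top (by simp) h2⟩
  · filter_upwards [hξ.integrable, hη.integrable] with ω h1 h2
    have hm := measurable_path_of_predictable hξ.predictable ω
    refine (lintegral_mono fun t => enorm_add_le _ _).trans_lt ?_
    rw [lintegral_add_left hm.enorm]
    exact ENNReal.add_lt_top.2 ⟨h1, h2⟩

end Market

/-! ### Optimal hedging -/

namespace Market

variable {M : Market Ω}

/-- Hedging `H` from the capital `x` above the floor `K` with the terminal wealth
`K + (G + v D)⁺`, `G = E[H | 𝔽̃_T] - K`, is optimal: the wealth in excess of `K` of any admissible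
strategy costs at most `x - Ẽ K`, and only the distance of the wealth to `E[H | 𝔽̃_T]` matters. -/
lemma risk_minimal {H K : Ω → ℝ} {x v : ℝ} {X : ℝ≥0 → Ω → ℝ} (hH : MemLp H 2 M.P)
    (hKm : StronglyMeasurable[M.obs M.T] K) (hK : MemLp K 2 M.P) (hv : v ≤ 0)
    (hprice : ∫ ω, max ((M.P[H | M.obs M.T]) ω - K ω + v * M.D ω) 0 ∂M.Pt = x - ∫ ω, K ω ∂M.Pt)
    (hX : ∀ᵐ ω ∂M.P,
      x + X M.T ω = K ω + max ((M.P[H | M.obs M.T]) ω - K ω + v * M.D ω) 0) :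
    M.risk H x X < ∞ ∧ ∀ η Y, M.Admissible x K η Y → M.risk H x X ≤ M.risk H x Y := by
  have hH1 : MemLp (M.P[H | M.obs M.T]) 2 M.P := hH.condExp one_le_two
  have hH1m : StronglyMeasurable[M.obs M.T] (M.P[H | M.obs M.T]) := stronglyMeasurable_condExp
  have hp : MemLp (fun ω => max ((M.P[H | M.obs M.T]) ω - K ω + v * M.D ω) 0) 2 M.P :=
    memLp_posPart_add_mul M.memLp_D (hH1.sub hK) v
  have hpm : StronglyMeasurable[M.obs M.T]
      fun ω => max ((M.P[H | M.obs M.T]) ω - K ω + v * M.D ω) 0 :=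
    stronglyMeasurable_posPart_add_mul M.stronglyMeasurable_D (hH1m.sub hKm) v
  set p : Ω → ℝ := fun ω => max ((M.P[H | M.obs M.T]) ω - K ω + v * M.D ω) 0 with hp_def
  have hf : MemLp (fun ω => K ω + p ω) 2 M.P := hK.add hp
  have hfm : StronglyMeasurable[M.obs M.T] (fun ω => K ω + p ω) := hKm.add hpm
  have hrisk : M.risk H x X = ENNReal.ofReal (∫ ω, (H ω - (K ω + p ω)) ^ 2 ∂M.P) := by
    have := lintegral_enorm_sq_eq (hH.sub hf)
    simp only [Pi.sub_apply] at this
    rw [← this, risk]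
    refine lintegral_congr_ae ?_
    filter_upwards [hX] with ω hω
    rw [sub_sub, hω]
  refine ⟨hrisk ▸ ENNReal.ofReal_lt_top, fun η Y hY => ?_⟩
  rcases eq_top_or_lt_top (M.risk H x Y) with htop | htop
  · exact htop ▸ le_top
  have hYm : StronglyMeasurable[M.obs M.T] (Y M.T) := hY.gains.adapted M.T
  have hYm' : AEStronglyMeasurable (Y M.T) M.P := (hYm.mono (M.obs.le M.T)).aestronglyMeasurable
  have hdiff : MemLp (fun ω => H ω - x - Y M.T ω) 2 M.P :=
    memLp_two_of_lintegral ((hH.1.sub aestronglyMeasurable_const).sub hYm') htop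
  have hY2 : MemLp (Y M.T) 2 M.P := by
    have h := (hH.sub (memLp_const x)).sub hdiff
    convert! h using 1
    ext ω
    simp
  have hw : MemLp (fun ω => x + Y M.T ω) 2 M.P := (memLp_const x).add hY2
  have hwm : StronglyMeasurable[M.obs M.T] (fun ω => x + Y M.T ω) :=
    stronglyMeasurable_const.add hYm
  have hriskY : M.risk H x Y = ENNReal.ofReal (∫ ω, (H ω - (x + Y M.T ω)) ^ 2 ∂M.P) := by
    rw [risk, lintegral_enorm_sq_eq hdiff]
    simp only [sub_sub]
  have hbudget := integral_terminal_le hY.gains hY.nonneg (M.integrable_Pt hYm hY2)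
  have hcost : ∫ ω, M.D ω * (x + Y M.T ω - K ω) ∂M.P ≤ ∫ ω, M.D ω * p ω ∂M.P := by
    rw [← M.integral_Pt (f := fun ω => x + Y M.T ω - K ω) (hwm.sub hKm), ← M.integral_Pt hpm,
      hprice, integral_sub (M.integrable_Pt hwm hw) (M.integrable_Pt hKm hK)]
    linarith
  have hproj := integral_sq_sub_posPart_le M.memLp_D (hH1.sub hK) hv (hw.sub hK)
    (by filter_upwards [hY.terminal] with ω hω using sub_nonneg.2 hω) hcost
  rw [hrisk, hriskY]
  refine ENNReal.ofReal_le_ofReal ?_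
  rw [integral_sq_sub_eq (M.obs.le M.T) hH hf hfm, integral_sq_sub_eq (M.obs.le M.T) hH hw hwm]
  refine add_le_add le_rfl ?_
  convert! hproj using 3 with ω ω
  · simp only [Pi.sub_apply, hp_def]; ring
  · simp only [Pi.sub_apply]; ring

/-- The multiplier for a claim `G` and a capital `g`, its sign, and the replication of the optimal
claim `(G + v D)⁺`, in terms of the martingale measure. -/
lemma exists_multiplier (hM : M.IsComplete) {G : Ω → ℝ} {g : ℝ}
    (hGm : StronglyMeasurable[M.obs M.T] G) (hG : MemLp G 2 M.P) (hG0 : ∀ᵐ ω ∂M.P, 0 ≤ G ω)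
    (hg : 0 < g) (hgG : g < ∫ ω, G ω ∂M.Pt) :
    (∃! v : ℝ, ∫ ω, max (G ω + v * M.D ω) 0 ∂M.Pt = g) ∧
    ∀ v : ℝ, ∫ ω, max (G ω + v * M.D ω) 0 ∂M.Pt = g →
      v ≤ 0 ∧ ∃ ξ, M.Replicates g (fun ω => max (G ω + v * M.D ω) 0) ξ := by
  have hpm : ∀ v : ℝ, StronglyMeasurable[M.obs M.T] fun ω => max (G ω + v * M.D ω) 0 := fun v =>
    stronglyMeasurable_posPart_add_mul M.stronglyMeasurable_D hGm v
  rw [M.integral_Pt hGm] at hgG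
  refine ⟨?_, fun v hv => ⟨?_, ?_⟩⟩
  · simp_rw [fun v => M.integral_Pt (hpm v)]
    exact existsUnique_multiplier M.memLp_D hG M.D_pos hG0 hg hgG
  · rw [M.integral_Pt (hpm v)] at hv
    exact multiplier_nonpos M.memLp_D hG M.D_pos hG0 (hv ▸ hgG)
  · obtain ⟨ξ, hξ⟩ := hM _ (hpm v) (memLp_posPart_add_mul M.memLp_D hG v)
      (ae_of_all _ fun ω => le_max_right _ _)
    exact ⟨ξ, hv ▸ hξ⟩

end Market

end Hedging

end

theorem theorem1 {Ω : Type*} [MeasurableSpace Ω] (M : Hedging.Market Ω) (hM : M.IsComplete) :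
    (∀ (G : Ω → ℝ) (g : ℝ), StronglyMeasurable[M.obs M.T] G → MemLp G 2 M.P →
      (∀ᵐ ω ∂M.P, 0 ≤ G ω) → 0 < g → g < ∫ ω, G ω ∂M.Pt →
      (∃! v : ℝ, ∫ ω, max (G ω + v * M.D ω) 0 ∂M.Pt = g) ∧
      ∀ v : ℝ, ∫ ω, max (G ω + v * M.D ω) 0 ∂M.Pt = g →
        (∃ ξ, M.Replicates g (fun ω => max (G ω + v * M.D ω) 0) ξ) ∧
        ∀ ξ, M.Replicates g (fun ω => max (G ω + v * M.D ω) 0) ξ → M.Solves g 0 G ξ) ∧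
    (∀ (H K : Ω → ℝ) (x : ℝ),
      StronglyMeasurable[M.full M.T] H → MemLp H 2 M.P → (∀ᵐ ω ∂M.P, 0 ≤ H ω) →
      StronglyMeasurable[M.obs M.T] K → MemLp K 2 M.P → (∀ᵐ ω ∂M.P, 0 ≤ K ω) →
      (∀ᵐ ω ∂M.P, K ω ≤ (M.P[H | M.obs M.T]) ω) →
      ∫ ω, K ω ∂M.Pt < x → x < ∫ ω, (M.P[H | M.obs M.T]) ω ∂M.Pt →
      (∃! v : ℝ,
        ∫ ω, max ((M.P[H | M.obs M.T]) ω - K ω + v * M.D ω) 0 ∂M.Pt = x - ∫ ω, K ω ∂M.Pt) ∧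
      ∀ v : ℝ,
        ∫ ω, max ((M.P[H | M.obs M.T]) ω - K ω + v * M.D ω) 0 ∂M.Pt = x - ∫ ω, K ω ∂M.Pt →
        (∃ ξ, M.Replicates (x - ∫ ω, K ω ∂M.Pt)
          (fun ω => max ((M.P[H | M.obs M.T]) ω - K ω + v * M.D ω) 0) ξ) ∧
        (∃ η, M.Replicates (∫ ω, K ω ∂M.Pt) K η) ∧
        ∀ ξ η, M.Replicates (x - ∫ ω, K ω ∂M.Pt)
            (fun ω => max ((M.P[H | M.obs M.T]) ω - K ω + v * M.D ω) 0) ξ →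
          M.Replicates (∫ ω, K ω ∂M.Pt) K η →
          M.Solves x K H (fun t ω => ξ t ω + η t ω)) := by
  refine ⟨fun G g hGm hG hG0 hg hgG => ?_, fun H K x _ hH _ hKm hK hK0 hHK hKx hxH => ?_⟩
  · obtain ⟨h1, h2⟩ := Hedging.Market.exists_multiplier hM hGm hG hG0 hg hgG
    refine ⟨h1, fun v hv => ⟨(h2 v hv).2, ?_⟩⟩
    rintro ξ ⟨X, hX, hXeq⟩
    have hce : M.P[G | M.obs M.T] = G :=
      condExp_of_stronglyMeasurable (M.obs.le M.T) hGm (hG.integrable one_le_two)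
    exact ⟨X, hX, Hedging.Market.risk_minimal (v := v) hG stronglyMeasurable_zero MemLp.zero
      (h2 v hv).1
      (by simpa [hce] using hv)
      (by filter_upwards [hXeq] with ω hω; simp [hce, ← hω])⟩
  · have hH1 : MemLp (M.P[H | M.obs M.T]) 2 M.P := hH.condExp one_le_two
    have hH1m : StronglyMeasurable[M.obs M.T] (M.P[H | M.obs M.T]) := stronglyMeasurable_condExp
    have hsub : ∫ ω, ((M.P[H | M.obs M.T]) ω - K ω) ∂M.Pt =
        ∫ ω, (M.P[H | M.obs M.T]) ω ∂M.Pt - ∫ ω, K ω ∂M.Pt :=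
      integral_sub (M.integrable_Pt hH1m hH1) (M.integrable_Pt hKm hK)
    obtain ⟨h1, h2⟩ := Hedging.Market.exists_multiplier hM (hH1m.sub hKm) (hH1.sub hK)
      (g := x - ∫ ω, K ω ∂M.Pt)
      (by filter_upwards [hHK] with ω hω using sub_nonneg.2 hω) (by linarith)
      (by simp only [Pi.sub_apply]; linarith)
    refine ⟨h1, fun v hv => ⟨(h2 v hv).2, hM K hKm hK hK0, ?_⟩⟩
    rintro ξ η ⟨X, hX, hXeq⟩ ⟨Y, hY, hYeq⟩
    have hsum : ∀ᵐ ω ∂M.P, x + (X M.T ω + Y M.T ω) =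
        K ω + max ((M.P[H | M.obs M.T]) ω - K ω + v * M.D ω) 0 := by
      filter_upwards [hXeq, hYeq] with ω e1 e2
      rw [e1]
      linarith
    refine ⟨fun t ω => X t ω + Y t ω, ⟨hX.strategy.add hY.strategy,
      hX.gains.add hX.strategy.predictable hY.strategy.predictable hY.gains, ?_, ?_⟩,
      Hedging.Market.risk_minimal hH hKm hK (h2 v hv).1 hv hsum⟩
    · filter_upwards [hX.nonneg, hY.nonneg] with ω e1 e2 t ht
      linarith [e1 t ht, e2 t ht]
    · filter_upwards [hsum] with ω e
      rw [e]
      linarith [le_max_right ((M.P[H | M.obs M.T]) ω - K ω + v * M.D ω) 0]
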